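/- Let $d\in\{1,3\}$ and $1<p\le\infty$. For open $\Omega\subset\mathbb R^d$ and $f\ge 0$ measurable write $\|f\|_{L^p(\Omega)}=\left(\int_\Omega f^p\,dx\right)^{1/p}$ if $p<\infty$ and $\|f\|_{L^\infty(\Omega)}=\operatorname{ess\,sup}_\Omega f$; thus $\||u|^2\|_{L^p(\Omega)}=\left(\int_\Omega|u|^{2p}\,dx\right)^{1/p}$ for $p<\infty$. Then there are constants $D_1,D_2>0$, depending only on $d$ and $p$, such that for every complex-valued $u\in C_0^\infty(\mathbb R^d\setminus\{0\})$ (smooth, with compact support in $\mathbb R^d\setminus\{0\}$) the following holds. (i) If $d=1$, then $$\big\||u|^2\big\|_{L^p(\Omega)}\le\int_\Omega\left(|u''(x)|^2-D_1\frac{|u(x)|^2}{x^4}+D_2|u(x)|^2\right)dx$$ both for $\Omega=(0,\infty)$ and for $\Omega=\mathbb R$. (ii) If $d=3$, then $$\big\||u|^2\big\|_{L^p(\mathbb R^3)}\le\int_{\mathbb R^3}\left(|\Delta u(x)|^2-D_1\frac{|u(x)|^2}{|x|^4}+D_2|u(x)|^2\right)dx .$$ -/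

import Mathlib

open MeasureTheory Set
open scoped ENNReal ContDiff Laplacian

/-- `u ∈ C₀^∞(E ∖ {0})`, where a function on `E ∖ {0}` with compact support in `E ∖ {0}` is
identified with its extension by zero to `E`: `u` is smooth, and its (closed) support is a compact
set that does not contain the origin. -/
def IsTestFunctionOffZero {E : Type*} [NormedAddCommGroup E] [NormedSpace ℝ E] (u : E → ℂ) :
    Prop :=
  ContDiff ℝ ∞ u ∧ HasCompactSupport u ∧ (0 : E) ∉ tsupport u

/-! Let `M` be the right-hand side. It suffices to bound both the sup and the integral of `|u|²` by
`M`; interpolation then gives every `p`. Rellich's inequality lets `D₁|u|²/|x|⁴` cost only half of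
`∫|Δu|²`. The other half, plus a multiple of `∫|u|²`, controls the sup by the Sobolev embedding of
`H²` in dimension below four (`SchwartzMap.exists_norm_sq_le_laplacian`). Rellich follows from two
Hardy inequalities, for `u` and for each `∂ᵢu`, since Hessian and Laplacian have the same `L²` norm.
On the half-line, `u` is extended by zero. -/

/-! ### Interpolation between `L¹` and `L^∞`. -/

/-- For finite `p`, integrate `|f|^p ≤ M^(p-1) |f|`. -/
theorem eLpNorm_le_of_bound_of_lintegral_le {α F : Type*} [MeasurableSpace α]
    [NormedAddCommGroup F] {μ : Measure α} {f : α → F} {p M : ℝ≥0∞} (hp : 1 ≤ p)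
    (hM : M ≠ ⊤) (hf : ∀ x, ‖f x‖ₑ ≤ M) (hint : ∫⁻ x, ‖f x‖ₑ ∂μ ≤ M) :
    eLpNorm f p μ ≤ M := by
  by_cases hp' : p = ⊤
  · subst hp'
    rw [eLpNorm_exponent_top]
    exact essSup_le_of_ae_le _ (Filter.Eventually.of_forall hf)
  have hp0 : p ≠ 0 := (zero_lt_one.trans_le hp).ne'
  have hr : 1 ≤ p.toReal := by
    simpa using (ENNReal.toReal_le_toReal ENNReal.one_ne_top hp').2 hp
  rw [eLpNorm_eq_lintegral_rpow_enorm_toReal hp0 hp']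
  have split (y : ℝ≥0∞) : y ^ p.toReal = y ^ (p.toReal - 1) * y := by
    conv_lhs => rw [← sub_add_cancel p.toReal 1]
    rw [ENNReal.rpow_add_of_nonneg _ _ (by linarith) zero_le_one, ENNReal.rpow_one]
  have key : ∫⁻ x, ‖f x‖ₑ ^ p.toReal ∂μ ≤ M ^ p.toReal := calc
    _ ≤ ∫⁻ x, M ^ (p.toReal - 1) * ‖f x‖ₑ ∂μ := by
      refine lintegral_mono fun x => ?_
      rw [split]
      gcongr
      exact hf x
    _ = M ^ (p.toReal - 1) * ∫⁻ x, ‖f x‖ₑ ∂μ :=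
      lintegral_const_mul' _ _ (ENNReal.rpow_ne_top_of_nonneg (by linarith) hM)
    _ ≤ M ^ (p.toReal - 1) * M := by gcongr
    _ = _ := (split M).symm
  calc _ ≤ (M ^ p.toReal) ^ (1 / p.toReal) := by gcongr
    _ = M := by rw [← ENNReal.rpow_mul, mul_one_div_cancel (by linarith), ENNReal.rpow_one]

/-! ### Sobolev embedding on the Fourier side. -/

section Sobolev

open SchwartzMap FourierTransform Real
open scoped LineDeriv

variable {E : Type*} [NormedAddCommGroup E] [InnerProductSpace ℝ E] [FiniteDimensional ℝ E]
  [MeasurableSpace E] [BorelSpace E]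

theorem SchwartzMap.norm_fourier_laplacian (f : 𝓢(E, ℂ)) (ξ : E) :
    ‖𝓕 (Δ f) ξ‖ = (2 * π) ^ 2 * ‖ξ‖ ^ 2 * ‖𝓕 f ξ‖ := by
  have h : 𝓕 (Δ f) = -(2 * π) ^ 2 • smulLeftCLM ℂ (fun x : E => ‖x‖ ^ 2) (𝓕 f) := by
    rw [laplacian_eq_fourierMultiplierCLM, fourierMultiplierCLM_apply,
      FourierTransform.fourier_smul, FourierTransform.fourier_fourierInv_eq]
  rw [h]
  simp only [_root_.smul_apply]
  rw [smulLeftCLM_apply_apply (by fun_prop)]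
  simp [mul_assoc, abs_of_pos pi_pos]

theorem SchwartzMap.norm_fourier_lineDeriv_lineDeriv (f : 𝓢(E, ℂ)) (v w ξ : E) :
    ‖𝓕 (∂_{v} (∂_{w} f)) ξ‖ = (2 * π) ^ 2 * (|inner ℝ ξ v| * |inner ℝ ξ w|) * ‖𝓕 f ξ‖ := by
  have h (g : 𝓢(E, ℂ)) (v : E) :
      ‖𝓕 (∂_{v} g) ξ‖ = 2 * π * |inner ℝ ξ v| * ‖𝓕 g ξ‖ := by
    rw [fourier_lineDerivOp_eq]
    simp only [_root_.smul_apply]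
    rw [smulLeftCLM_apply_apply (by fun_prop)]
    simp [mul_assoc, abs_of_pos pi_pos]
  rw [h, h]
  ring

theorem SchwartzMap.integrable_norm_sq (f : 𝓢(E, ℂ)) : Integrable fun x => ‖f x‖ ^ 2 :=
  (memLp_two_iff_integrable_sq_norm f.continuous.aestronglyMeasurable).1 (f.memLp 2)

/-- The `L²` norms of the Hessian and of the Laplacian of a Schwartz function agree. -/
theorem SchwartzMap.sum_integral_norm_sq_lineDeriv_lineDeriv {ι : Type*} [Fintype ι]
    (b : OrthonormalBasis ι ℝ E) (f : 𝓢(E, ℂ)) :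
    ∑ i, ∑ j, ∫ x, ‖∂_{b j} (∂_{b i} f) x‖ ^ 2 = ∫ x, ‖(Δ f : 𝓢(E, ℂ)) x‖ ^ 2 := by
  rw [← integral_norm_sq_fourier (Δ f : 𝓢(E, ℂ))]
  have hP (i j : ι) := integral_norm_sq_fourier (∂_{b j} (∂_{b i} f))
  simp_rw [← hP]
  have hI (i j : ι) : Integrable fun ξ => ‖𝓕 (∂_{b j} (∂_{b i} f)) ξ‖ ^ 2 :=
    integrable_norm_sq _
  simp_rw [← integral_finsetSum _ fun j _ => hI _ j]
  rw [← integral_finsetSum _ fun i _ => integrable_finsetSum _ fun j _ => hI i j]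
  congr 1 with ξ
  simp_rw [norm_fourier_lineDeriv_lineDeriv, norm_fourier_laplacian, mul_pow, sq_abs]
  -- Parseval reduces the claim to `∑ᵢⱼ ξᵢ² ξⱼ² = |ξ|⁴`.
  simp_rw [← Finset.sum_mul, ← Finset.mul_sum, ← Finset.sum_mul, b.sum_sq_inner_left, ← Finset.mul_sum,
    b.sum_sq_inner_left]
  ring

/-- `|ξ|⁻⁴` is integrable at infinity in dimension below four, so by dominated convergence the
integral tends to zero as `C = n + 1` grows. -/
theorem exists_integral_inv_mul_norm_pow_four_add_le_one (hE : Module.finrank ℝ E < 4) {a : ℝ}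
    (ha : 1 ≤ a) : ∃ C : ℝ, 0 < C ∧ Integrable (fun ξ : E => (a * ‖ξ‖ ^ 4 + C)⁻¹) ∧
      ∫ ξ : E, (a * ‖ξ‖ ^ 4 + C)⁻¹ ≤ 1 := by
  have hmaj : Integrable fun ξ : E => 2 * (1 + ‖ξ‖ ^ 2) ^ (-(4 : ℝ) / 2) :=
    (integrable_rpow_neg_one_add_norm_sq (by exact_mod_cast hE)).const_mul 2
  have hle (n : ℕ) (ξ : E) :
      ‖(a * ‖ξ‖ ^ 4 + ((n : ℝ) + 1))⁻¹‖ ≤ 2 * (1 + ‖ξ‖ ^ 2) ^ (-(4 : ℝ) / 2) := by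
    rw [show -(4 : ℝ) / 2 = -(2 : ℕ) by norm_num, rpow_neg (by positivity), rpow_natCast,
      norm_of_nonneg (by positivity), ← div_eq_mul_inv, inv_eq_one_div,
      div_le_div_iff₀ (by positivity) (by positivity)]
    have := (Nat.cast_nonneg n : (0 : ℝ) ≤ n)
    have := mul_le_mul_of_nonneg_right ha (by positivity : 0 ≤ ‖ξ‖ ^ 4)
    nlinarith [sq_nonneg (‖ξ‖ ^ 2 - 1)]
  have hmeas (n : ℕ) :
      AEStronglyMeasurable (fun ξ : E => (a * ‖ξ‖ ^ 4 + ((n : ℝ) + 1))⁻¹) volume := by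
    refine Continuous.aestronglyMeasurable (Continuous.inv₀ (by fun_prop) fun ξ => ?_)
    positivity
  have hlim := tendsto_integral_of_dominated_convergence (μ := (volume : Measure E))
    (F := fun (n : ℕ) ξ => (a * ‖ξ‖ ^ 4 + ((n : ℝ) + 1))⁻¹) (f := fun _ => 0) _ hmeas hmaj
    (fun n => Filter.Eventually.of_forall (hle n))
    (Filter.Eventually.of_forall fun ξ => Filter.Tendsto.inv_tendsto_atTop
      (Filter.tendsto_atTop_add_const_left _ _
        (Filter.tendsto_atTop_add_const_right _ _ tendsto_natCast_atTop_atTop)))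
  rw [integral_zero] at hlim
  obtain ⟨n, hn⟩ := (hlim.eventually_le_const zero_lt_one).exists
  exact ⟨n + 1, by positivity, hmaj.mono' (hmeas n) (Filter.Eventually.of_forall (hle n)), hn⟩

/-- In dimension at most three, `H²` embeds in `L^∞`, with an arbitrarily small share of the
Laplacian; the share `1 / 2` is singled out. -/
theorem SchwartzMap.exists_norm_sq_le_laplacian (hE : Module.finrank ℝ E < 4) :
    ∃ C : ℝ, 0 < C ∧ ∀ (f : 𝓢(E, ℂ)) (x : E),
      ‖f x‖ ^ 2 ≤ 1 / 2 * (∫ y, ‖(Δ f : 𝓢(E, ℂ)) y‖ ^ 2) + C * ∫ y, ‖f y‖ ^ 2 := by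
  -- Chosen so that `a |ξ|⁴ |𝓕 f|²` is half of `|𝓕 (Δ f)|²`.
  set a : ℝ := 1 / 2 * (2 * π) ^ 4 with ha
  have ha1 : 1 ≤ a := by
    have : (2 : ℝ) ^ 4 ≤ (2 * π) ^ 4 := by gcongr; linarith [pi_gt_three]
    rw [ha]; linarith
  obtain ⟨C, hC, hint, hle⟩ := exists_integral_inv_mul_norm_pow_four_add_le_one hE ha1
  refine ⟨C, hC, fun f x => ?_⟩
  set S := ∫ ξ, ‖𝓕 f ξ‖ with hS
  have hfx : ‖f x‖ ≤ S := by
    have h : f x = ∫ ξ, 𝐞 (inner ℝ ξ x) • 𝓕 f ξ := by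
      conv_lhs => rw [← FourierTransform.fourierInv_fourier_eq (F := 𝓢(E, ℂ)) f]
      rw [fourierInv_coe, Real.fourierInv_eq]
    rw [h]
    refine (norm_integral_le_integral_norm _).trans_eq ?_
    simp [hS]
  have hJ : ∫ ξ, (a * ‖ξ‖ ^ 4 + C) * ‖𝓕 f ξ‖ ^ 2 =
      1 / 2 * (∫ y, ‖(Δ f : 𝓢(E, ℂ)) y‖ ^ 2) + C * ∫ y, ‖f y‖ ^ 2 := by
    rw [← integral_norm_sq_fourier (Δ f : 𝓢(E, ℂ)), ← integral_norm_sq_fourier f, ← integral_const_mul,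
      ← integral_const_mul, ← integral_add ((integrable_norm_sq _).const_mul _)
        ((integrable_norm_sq _).const_mul _)]
    congr 1 with ξ
    rw [norm_fourier_laplacian, ha]
    ring
  have hJi : Integrable fun ξ => (a * ‖ξ‖ ^ 4 + C) * ‖𝓕 f ξ‖ ^ 2 := by
    refine (((integrable_norm_sq (𝓕 (Δ f))).const_mul (1 / 2)).add
      ((integrable_norm_sq (𝓕 f)).const_mul C)).congr (Filter.Eventually.of_forall fun ξ => ?_)
    simp only [Pi.add_apply]
    rw [norm_fourier_laplacian, ha]
    ring
  -- Cauchy–Schwarz with weight `w = a|ξ|⁴ + C`: integrating `w⁻¹(S - w|𝓕 f|)² ≥ 0` gives `2S² ≤ S²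
  -- ∫ w⁻¹ + ∫ w|𝓕 f|²`, and `∫ w⁻¹ ≤ 1`.
  have hpos : 0 ≤ ∫ ξ : E, (S ^ 2 * (a * ‖ξ‖ ^ 4 + C)⁻¹ - 2 * S * ‖𝓕 f ξ‖ +
      (a * ‖ξ‖ ^ 4 + C) * ‖𝓕 f ξ‖ ^ 2) := by
    refine integral_nonneg fun ξ => ?_
    have hw : 0 < a * ‖ξ‖ ^ 4 + C := by positivity
    have : S ^ 2 * (a * ‖ξ‖ ^ 4 + C)⁻¹ - 2 * S * ‖𝓕 f ξ‖ + (a * ‖ξ‖ ^ 4 + C) * ‖𝓕 f ξ‖ ^ 2 =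
        (a * ‖ξ‖ ^ 4 + C)⁻¹ * (S - (a * ‖ξ‖ ^ 4 + C) * ‖𝓕 f ξ‖) ^ 2 := by
      field_simp
      ring
    simp only [Pi.zero_apply]
    rw [this]
    positivity
  have hN : Integrable fun ξ => ‖𝓕 f ξ‖ := (𝓕 f).integrable.norm
  have hd : Integrable fun ξ : E => S ^ 2 * (a * ‖ξ‖ ^ 4 + C)⁻¹ - 2 * S * ‖𝓕 f ξ‖ :=
    (hint.const_mul _).sub (hN.const_mul _)
  rw [integral_add hd hJi, integral_sub (hint.const_mul _) (hN.const_mul _), integral_const_mul, integral_const_mul,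
    ← hS, hJ] at hpos
  have := pow_le_pow_left₀ (norm_nonneg _) hfx 2
  nlinarith [mul_le_mul_of_nonneg_left hle (sq_nonneg S)]

end Sobolev

/-! ### Weighted Hardy inequalities. -/

section Hardy

variable {E : Type*} [NormedAddCommGroup E] [InnerProductSpace ℝ E]

theorem IsTestFunctionOffZero.fderiv_apply {u : E → ℂ} (hu : IsTestFunctionOffZero u) (v : E) :
    IsTestFunctionOffZero fun x => fderiv ℝ u x v :=
  ⟨(hu.1.fderiv_right (m := ∞) (by simp)).clm_apply contDiff_const, hu.2.1.fderiv_apply ℝ v,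
    fun h => hu.2.2 (tsupport_fderiv_apply_subset ℝ v h)⟩

/-- The quotient by a power of the norm of a function that is `C¹` and vanishes near the origin. -/
theorem contDiff_div_norm_pow {f : E → ℝ} (hf : ContDiff ℝ 1 f) (h0 : (0 : E) ∉ tsupport f)
    (k : ℕ) : ContDiff ℝ 1 fun x => f x / ‖x‖ ^ k := by
  refine contDiff_iff_contDiffAt.2 fun x => ?_
  by_cases hx : x ∈ tsupport fun x => f x / ‖x‖ ^ k
  swap
  · exact contDiffAt_const.congr_of_eventuallyEq (notMem_tsupport_iff_eventuallyEq.1 hx)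
  have hx0 : x ≠ 0 := by
    rintro rfl
    exact h0 (closure_mono (t := Function.support f)
      (Function.support_subset_iff'.2 fun y hy => by simp [Function.notMem_support.1 hy]) hx)
  exact hf.contDiffAt.div ((contDiffAt_norm ℝ hx0).pow k) (by simp [hx0])

theorem HasCompactSupport.div_norm_pow {E : Type*} [NormedAddCommGroup E] {f : E → ℝ} (hf : HasCompactSupport f) (k : ℕ) :
    HasCompactSupport fun x => f x / ‖x‖ ^ k :=
  hf.mono fun y hy hfy => hy (by simp [hfy])

theorem contDiff_norm_sq_comp {u : E → ℂ} (hu : IsTestFunctionOffZero u) :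
    ContDiff ℝ 1 (fun x => ‖u x‖ ^ 2) ∧ HasCompactSupport (fun x => ‖u x‖ ^ 2) ∧
      (0 : E) ∉ tsupport fun x => ‖u x‖ ^ 2 :=
  ⟨(hu.1.of_le (by simp)).norm_sq ℝ, hu.2.1.mono fun y hy h => hy (by simp [h]),
    fun h => hu.2.2 (closure_mono (t := Function.support u)
      (Function.support_subset_iff'.2 fun y hy => by simp [Function.notMem_support.1 hy]) h)⟩

/-- Cauchy–Schwarz in coordinates; it bounds the radial derivative `x·∇u` by the full gradient. -/
theorem norm_apply_sq_le_sum {ι : Type*} [Fintype ι] (b : OrthonormalBasis ι ℝ E)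
    (L : E →L[ℝ] ℂ) (x : E) : ‖L x‖ ^ 2 ≤ ‖x‖ ^ 2 * ∑ i, ‖L (b i)‖ ^ 2 := by
  have h : ‖L x‖ ≤ ∑ i, |inner ℝ (b i) x| * ‖L (b i)‖ := by
    conv_lhs => rw [← b.sum_repr' x, map_sum]
    refine (norm_sum_le _ _).trans_eq (Finset.sum_congr rfl fun i _ => ?_)
    rw [map_smul, norm_smul, Real.norm_eq_abs]
  calc ‖L x‖ ^ 2 ≤ (∑ i, |inner ℝ (b i) x| * ‖L (b i)‖) ^ 2 := by gcongr
    _ ≤ (∑ i, |inner ℝ (b i) x| ^ 2) * ∑ i, ‖L (b i)‖ ^ 2 := Finset.sum_mul_sq_le_sq_mul_sq _ _ _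
    _ = _ := by simp_rw [sq_abs, b.sum_sq_inner_right]

variable [FiniteDimensional ℝ E] [MeasurableSpace E] [BorelSpace E]

theorem IsTestFunctionOffZero.integrable_norm_sq_div {u : E → ℂ} (hu : IsTestFunctionOffZero u)
    (k : ℕ) : Integrable fun x => ‖u x‖ ^ 2 / ‖x‖ ^ k :=
  have h := contDiff_norm_sq_comp hu
  (contDiff_div_norm_pow h.1 h.2.2 k).continuous.integrable_of_hasCompactSupport
    (h.2.1.div_norm_pow k)

/-- Integrating the divergence of `x ↦ v x • x` over the whole space. -/
theorem integral_fderiv_apply_self {v : E → ℝ} (hv : ContDiff ℝ 1 v) (hc : HasCompactSupport v) :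
    ∫ x, fderiv ℝ v x x = -(Module.finrank ℝ E * ∫ x, v x) := by
  set b := stdOrthonormalBasis ℝ E
  have hDc (w : E) : Continuous fun x => fderiv ℝ v x w :=
    (hv.continuous_fderiv one_ne_zero).clm_apply continuous_const
  have hI (i) : Integrable fun x => inner ℝ (b i) x * fderiv ℝ v x (b i) :=
    (Continuous.mul (by fun_prop) (hDc _)).integrable_of_hasCompactSupport
      (hc.fderiv_apply ℝ (b i)).mul_left
  have hvI : Integrable v := hv.continuous.integrable_of_hasCompactSupport hc
  have hfd (i) (x : E) : fderiv ℝ (fun y => inner ℝ (b i) y) x (b i) = 1 := by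
    have : (fun y => inner ℝ (b i) y) = innerSL ℝ (b i) := rfl
    rw [this, ContinuousLinearMap.fderiv]
    simp
  have hparts (i) : ∫ x, inner ℝ (b i) x * fderiv ℝ v x (b i) = -∫ x, v x := by
    have h := integral_mul_fderiv_eq_neg_fderiv_mul_of_integrable (μ := (volume : Measure E))
      (f := fun x => inner ℝ (b i) x) (g := v) (v := b i) (by simpa [hfd] using hvI) (hI i)
      ((Continuous.mul (by fun_prop) hv.continuous).integrable_of_hasCompactSupport hc.mul_left)
      (fun x _ => (innerSL ℝ (b i)).differentiableAt) (fun x _ => hv.differentiable one_ne_zero x)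
    simpa [hfd] using h
  have hsum (x : E) : fderiv ℝ v x x = ∑ i, inner ℝ (b i) x * fderiv ℝ v x (b i) := by
    conv_lhs => rw [← b.sum_repr' x, map_sum]
    simp [b.sum_repr' x]
  simp_rw [hsum]
  rw [integral_finsetSum _ fun i _ => hI i]
  simp [hparts]

/-- Hardy's inequality with power weights, for functions vanishing near the origin. -/
theorem IsTestFunctionOffZero.hardy {ι : Type*} [Fintype ι] (b : OrthonormalBasis ι ℝ E)
    {u : E → ℂ} (hu : IsTestFunctionOffZero u) (k : ℕ) :
    ((Module.finrank ℝ E : ℝ) - (k + 2)) ^ 2 * ∫ x, ‖u x‖ ^ 2 / ‖x‖ ^ (k + 2) ≤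
      4 * ∑ i, ∫ x, ‖fderiv ℝ u x (b i)‖ ^ 2 / ‖x‖ ^ k := by
  set m : ℝ := (Module.finrank ℝ E : ℝ) - (k + 2) with hm
  obtain ⟨hC, hK, h0⟩ := contDiff_norm_sq_comp hu
  set v : E → ℝ := fun x => ‖u x‖ ^ 2 / ‖x‖ ^ (k + 2) with hv
  have hvC : ContDiff ℝ 1 v := contDiff_div_norm_pow hC h0 _
  have hvK : HasCompactSupport v := hK.div_norm_pow _
  have hvI : Integrable v := hvC.continuous.integrable_of_hasCompactSupport hvK
  have hDI : Integrable fun x => fderiv ℝ v x x := by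
    refine ((hvC.continuous_fderiv one_ne_zero).clm_apply
      continuous_id).integrable_of_hasCompactSupport ?_
    exact (hvK.fderiv (𝕜 := ℝ)).mono fun x hx h => hx (by simp [h])
  have hRI (i) : Integrable fun x => ‖fderiv ℝ u x (b i)‖ ^ 2 / ‖x‖ ^ k :=
    (hu.fderiv_apply (b i)).integrable_norm_sq_div k
  have hD (x : E) : fderiv ℝ v x x =
      2 * inner ℝ (u x) (fderiv ℝ u x x) / ‖x‖ ^ (k + 2) - (k + 2) * v x := by
    -- At the origin both sides vanish, as division by zero gives zero.
    rcases eq_or_ne x 0 with rfl | hx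
    · simp [hv]
    have hx' : 0 < ‖x‖ := norm_pos_iff.2 hx
    have hud : HasFDerivAt u (fderiv ℝ u x) x :=
      (hu.1.differentiable (by simp) x).hasFDerivAt
    have hnd : HasFDerivAt (fun y : E => ‖y‖) (fderiv ℝ (fun y : E => ‖y‖) x) x :=
      ((contDiffAt_norm ℝ hx).differentiableAt one_ne_zero).hasFDerivAt
    have hnx : fderiv ℝ (fun y : E => ‖y‖) x x = ‖x‖ :=
      hnd.differentiableAt.fderiv_norm_self
    have hd := hud.norm_sq.mul ((hasDerivAt_inv (by positivity)).comp_hasFDerivAt x (hnd.pow (k + 2)))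
    have hveq : v = fun y => ‖u y‖ ^ 2 * (‖y‖ ^ (k + 2))⁻¹ := by
      ext y; simp only [hv, div_eq_mul_inv]
    replace hd := HasFDerivAt.fderiv hd
    change fderiv ℝ (fun y => ‖u y‖ ^ 2 * (‖y‖ ^ (k + 2))⁻¹) x = _ at hd
    rw [hveq, hd]
    simp [hnx]
    field_simp
    ring
  -- This comes from `|m u + 2 x·∇u|² / |x|^(k+2) ≥ 0`, the cross term being written as a derivative
  -- of `v`. By the divergence identity the cross term integrates to `-2m² ∫ v`, leaving `m² ∫ v` on
  -- the small side.
  have hpt (x : E) : 0 ≤ m ^ 2 * v x + 2 * m * (fderiv ℝ v x x + (k + 2) * v x) +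
      4 * ∑ i, ‖fderiv ℝ u x (b i)‖ ^ 2 / ‖x‖ ^ k := by
    rw [hD]
    rcases eq_or_ne x 0 with rfl | hx
    · simp [hv]; positivity
    have hx' : 0 < ‖x‖ := norm_pos_iff.2 hx
    have hsq : 0 ≤ ‖m • u x + (2 : ℝ) • fderiv ℝ u x x‖ ^ 2 / ‖x‖ ^ (k + 2) := by positivity
    have hexp : ‖m • u x + (2 : ℝ) • fderiv ℝ u x x‖ ^ 2 =
        m ^ 2 * ‖u x‖ ^ 2 + 4 * m * inner ℝ (u x) (fderiv ℝ u x x) +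
          4 * ‖fderiv ℝ u x x‖ ^ 2 := by
      rw [norm_add_sq_real, real_inner_smul_left, real_inner_smul_right, norm_smul, norm_smul,
        mul_pow, mul_pow, Real.norm_eq_abs, sq_abs]
      norm_num
      ring
    have hle : ‖fderiv ℝ u x x‖ ^ 2 / ‖x‖ ^ (k + 2) ≤
        ∑ i, ‖fderiv ℝ u x (b i)‖ ^ 2 / ‖x‖ ^ k := by
      rw [← Finset.sum_div, div_le_div_iff₀ (by positivity) (by positivity)]
      have := mul_le_mul_of_nonneg_right (norm_apply_sq_le_sum b (fderiv ℝ u x) x)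
        (by positivity : 0 ≤ ‖x‖ ^ k)
      calc _ ≤ _ := this
        _ = _ := by ring
    rw [hexp, add_div, add_div, mul_div_assoc, mul_div_assoc 4 (‖fderiv ℝ u x x‖ ^ 2)] at hsq
    have e : 2 * m * (2 * inner ℝ (u x) (fderiv ℝ u x x) / ‖x‖ ^ (k + 2) - (k + 2) * v x +
        (k + 2) * v x) = 4 * m * inner ℝ (u x) (fderiv ℝ u x x) / ‖x‖ ^ (k + 2) := by ring
    rw [e]
    simp only [hv]
    linarith
  have hint := integral_nonneg (μ := (volume : Measure E)) (Pi.le_def.2 hpt)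
  have hS := integrable_finsetSum Finset.univ fun i _ => hRI i
  have h1 : Integrable fun x => fderiv ℝ v x x + (k + 2) * v x := hDI.add (hvI.const_mul _)
  have h2 : Integrable fun x => m ^ 2 * v x + 2 * m * (fderiv ℝ v x x + (k + 2) * v x) :=
    (hvI.const_mul _).add (h1.const_mul _)
  have e1 : ∫ x, (fderiv ℝ v x x + (k + 2) * v x) = -m * ∫ x, v x := by
    rw [integral_add hDI (hvI.const_mul _), integral_const_mul, integral_fderiv_apply_self hvC hvK,
      hm]
    ring
  have e2 : ∫ x, ((m ^ 2 * v x + 2 * m * (fderiv ℝ v x x + (k + 2) * v x)) +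
      4 * ∑ i, ‖fderiv ℝ u x (b i)‖ ^ 2 / ‖x‖ ^ k) = m ^ 2 * (∫ x, v x) +
      2 * m * (-m * ∫ x, v x) + 4 * ∑ i, ∫ x, ‖fderiv ℝ u x (b i)‖ ^ 2 / ‖x‖ ^ k := by
    rw [integral_add h2 (hS.const_mul 4), integral_add (hvI.const_mul _) (h1.const_mul _),
      integral_const_mul, integral_const_mul, integral_const_mul, integral_finsetSum _
      fun i _ => hRI i, e1]
  rw [e2] at hint
  linarith

end Hardy

/-! ### Rellich's inequality and the bound on the whole space. -/

section Rellich

open SchwartzMap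
open scoped LineDeriv

variable {E : Type*} [NormedAddCommGroup E] [InnerProductSpace ℝ E] [FiniteDimensional ℝ E]

theorem IsTestFunctionOffZero.exists_schwartzMap {u : E → ℂ} (hu : IsTestFunctionOffZero u) :
    ∃ f : 𝓢(E, ℂ), (f : E → ℂ) = u ∧ ((Δ f : 𝓢(E, ℂ)) : E → ℂ) = Δ u := by
  refine ⟨hu.2.1.toSchwartzMap hu.1, rfl, ?_⟩
  ext x
  rw [laplacian_apply]
  rfl

variable [MeasurableSpace E] [BorelSpace E]

/-- Rellich's inequality for functions vanishing near the origin. -/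
theorem IsTestFunctionOffZero.rellich {u : E → ℂ} (hu : IsTestFunctionOffZero u) :
    ((Module.finrank ℝ E : ℝ) - 2) ^ 2 * ((Module.finrank ℝ E : ℝ) - 4) ^ 2 *
      ∫ x, ‖u x‖ ^ 2 / ‖x‖ ^ 4 ≤ 16 * ∫ x, ‖(Δ u) x‖ ^ 2 := by
  obtain ⟨f, rfl, hΔ⟩ := hu.exists_schwartzMap
  set b := stdOrthonormalBasis ℝ E
  have h4 := hu.hardy b 2
  have h2 : ((Module.finrank ℝ E : ℝ) - 2) ^ 2 *
      ∑ i, ∫ x, ‖fderiv ℝ f x (b i)‖ ^ 2 / ‖x‖ ^ 2 ≤ 4 * ∫ x, ‖(Δ (f : E → ℂ)) x‖ ^ 2 := by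
    rw [← hΔ, ← sum_integral_norm_sq_lineDeriv_lineDeriv b f, Finset.mul_sum, Finset.mul_sum]
    refine Finset.sum_le_sum fun i _ => ?_
    -- Unweighted Hardy for each `∂ᵢu`; the sum over `i` produces the full Hessian.
    have h := (hu.fderiv_apply (b i)).hardy b 0
    norm_num at h
    exact h
  norm_num at h4
  nlinarith [mul_le_mul_of_nonneg_left h4 (sq_nonneg ((Module.finrank ℝ E : ℝ) - 2))]

theorem IsTestFunctionOffZero.integrable_norm_sq_laplacian {u : E → ℂ}
    (hu : IsTestFunctionOffZero u) : Integrable fun x => ‖(Δ u) x‖ ^ 2 := by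
  obtain ⟨f, rfl, hΔ⟩ := hu.exists_schwartzMap
  rw [← hΔ]
  exact integrable_norm_sq _

theorem exists_eLpNorm_le_integral_laplacian
    (hE : Module.finrank ℝ E = 1 ∨ Module.finrank ℝ E = 3) {p : ℝ≥0∞} (hp : 1 ≤ p) :
    ∃ D₁ D₂ : ℝ, 0 < D₁ ∧ 0 < D₂ ∧ ∀ u : E → ℂ, IsTestFunctionOffZero u →
      eLpNorm (fun x => ‖u x‖ ^ 2) p volume ≤ ENNReal.ofReal (∫ x,
        (‖(Δ u) x‖ ^ 2 - D₁ * (‖u x‖ ^ 2 / ‖x‖ ^ 4) + D₂ * ‖u x‖ ^ 2)) := by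
  obtain ⟨C, hC, hsob⟩ := exists_norm_sq_le_laplacian (E := E) (by omega)
  -- By Rellich with constant 16, `1 / 32` uses up half of `∫|Δu|²`. The `1` in `C + 1` pays for the
  -- `L¹` norm of `|u|²`. Neither constant depends on `p`.
  refine ⟨1 / 32, C + 1, by norm_num, by positivity, fun u hu => ?_⟩
  have hrel : ∫ x, ‖u x‖ ^ 2 / ‖x‖ ^ 4 ≤ 16 * ∫ x, ‖(Δ u) x‖ ^ 2 := by
    have h := hu.rellich
    have h0 : 0 ≤ ∫ x, ‖u x‖ ^ 2 / ‖x‖ ^ 4 := integral_nonneg fun x => by positivity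
    -- The factor `(d-2)²(d-4)²` is 9 for `d = 1` and 1 for `d = 3`.
    rcases hE with hE | hE <;> rw [hE] at h <;> norm_num at h <;> linarith
  have hsup (x : E) :
      ‖u x‖ ^ 2 ≤ 1 / 2 * (∫ y, ‖(Δ u) y‖ ^ 2) + C * ∫ y, ‖u y‖ ^ 2 := by
    obtain ⟨f, rfl, hΔ⟩ := hu.exists_schwartzMap
    simpa only [hΔ] using hsob f x
  have hu2 : Integrable fun x => ‖u x‖ ^ 2 := by simpa using hu.integrable_norm_sq_div 0
  have hu4 := (hu.integrable_norm_sq_div 4).const_mul (1 / 32)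
  have hΔ2 := hu.integrable_norm_sq_laplacian
  have hd : Integrable fun x => ‖(Δ u) x‖ ^ 2 - 1 / 32 * (‖u x‖ ^ 2 / ‖x‖ ^ 4) := hΔ2.sub hu4
  have h0 : 0 ≤ ∫ x, ‖u x‖ ^ 2 := integral_nonneg fun x => by positivity
  have hΔ0 : 0 ≤ ∫ x, ‖(Δ u) x‖ ^ 2 := integral_nonneg fun x => by positivity
  have hC0 : 0 ≤ C * ∫ x, ‖u x‖ ^ 2 := by positivity
  rw [integral_add hd (hu2.const_mul _), integral_sub hΔ2 hu4, integral_const_mul,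
    integral_const_mul]
  refine eLpNorm_le_of_bound_of_lintegral_le hp ENNReal.ofReal_ne_top (fun x => ?_) ?_
  · rw [Real.enorm_eq_ofReal (by positivity)]
    exact ENNReal.ofReal_le_ofReal (by linarith [hsup x])
  · simp_rw [fun x => Real.enorm_eq_ofReal (sq_nonneg ‖u x‖)]
    rw [← ofReal_integral_eq_lintegral_ofReal hu2
      (Filter.Eventually.of_forall fun x => by positivity)]
    exact ENNReal.ofReal_le_ofReal (by linarith)

end Rellich

/-! ### Extension by zero from the half-line. -/

section HalfLine

/-- As `u` vanishes near the origin, cutting it off there creates no jump. -/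
theorem indicator_Ioi_eventuallyEq {u : ℝ → ℂ} (hu : IsTestFunctionOffZero u) (x : ℝ) :
    (x ∈ Ioi (0 : ℝ) ∧ (Ioi 0).indicator u =ᶠ[nhds x] u) ∨
      (x ∉ Ioi (0 : ℝ) ∧ (Ioi 0).indicator u =ᶠ[nhds x] 0) := by
  rcases lt_trichotomy x 0 with hx | rfl | hx
  · refine .inr ⟨not_lt.2 hx.le, ?_⟩
    filter_upwards [Iio_mem_nhds hx] with y hy
    exact indicator_of_notMem (not_lt.2 (le_of_lt hy)) u
  · refine .inr ⟨self_notMem_Ioi, ?_⟩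
    filter_upwards [notMem_tsupport_iff_eventuallyEq.1 hu.2.2] with y hy
    simp [indicator_apply, hy]
  · refine .inl ⟨hx, ?_⟩
    filter_upwards [Ioi_mem_nhds hx] with y hy
    exact indicator_of_mem hy u

theorem IsTestFunctionOffZero.indicator_Ioi {u : ℝ → ℂ} (hu : IsTestFunctionOffZero u) :
    IsTestFunctionOffZero ((Ioi (0 : ℝ)).indicator u) := by
  have hs : Function.support ((Ioi (0 : ℝ)).indicator u) ⊆ Function.support u := by
    rw [support_indicator]
    exact inter_subset_right
  refine ⟨contDiff_iff_contDiffAt.2 fun x => ?_, hu.2.1.mono hs,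
    fun h => hu.2.2 (closure_mono hs h)⟩
  rcases indicator_Ioi_eventuallyEq hu x with ⟨-, h⟩ | ⟨-, h⟩
  · exact hu.1.contDiffAt.congr_of_eventuallyEq h
  · exact contDiffAt_const.congr_of_eventuallyEq h

theorem deriv_deriv_indicator_Ioi {u : ℝ → ℂ} (hu : IsTestFunctionOffZero u) (x : ℝ) :
    deriv (deriv ((Ioi (0 : ℝ)).indicator u)) x = (Ioi (0 : ℝ)).indicator (deriv (deriv u)) x := by
  rcases indicator_Ioi_eventuallyEq hu x with ⟨hx, h⟩ | ⟨hx, h⟩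
  · rw [indicator_of_mem hx, h.deriv.deriv_eq]
  · rw [indicator_of_notMem hx, h.deriv.deriv_eq]
    simp

end HalfLine

/- For `1 < p < ∞`, `eLpNorm (fun x => ‖u x‖ ^ 2) p` is `(∫ |u|^(2p))^(1/p)`; for `p = ∞` it is the
essential supremum of `|u|²`. It is an extended non-negative real, so its being at most
`ENNReal.ofReal` of the right-hand side includes its finiteness. -/
theorem mainTheorem4 (p : ℝ≥0∞) (hp : 1 < p) :
    -- dimension one, on the half-line and on the whole line
    (∃ D₁ D₂ : ℝ, 0 < D₁ ∧ 0 < D₂ ∧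
      ∀ u : ℝ → ℂ, IsTestFunctionOffZero u →
        eLpNorm (fun x => ‖u x‖ ^ 2) p (volume.restrict (Ioi (0 : ℝ))) ≤
          ENNReal.ofReal (∫ x in Ioi (0 : ℝ),
            (‖deriv (deriv u) x‖ ^ 2 - D₁ * (‖u x‖ ^ 2 / x ^ 4) + D₂ * ‖u x‖ ^ 2)) ∧
        eLpNorm (fun x => ‖u x‖ ^ 2) p volume ≤
          ENNReal.ofReal (∫ x : ℝ,
            (‖deriv (deriv u) x‖ ^ 2 - D₁ * (‖u x‖ ^ 2 / x ^ 4) + D₂ * ‖u x‖ ^ 2))) ∧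
    -- dimension three
    (∃ D₁ D₂ : ℝ, 0 < D₁ ∧ 0 < D₂ ∧
      ∀ u : EuclideanSpace ℝ (Fin 3) → ℂ, IsTestFunctionOffZero u →
        eLpNorm (fun x => ‖u x‖ ^ 2) p volume ≤
          ENNReal.ofReal (∫ x : EuclideanSpace ℝ (Fin 3),
            (‖(Δ u) x‖ ^ 2 - D₁ * (‖u x‖ ^ 2 / ‖x‖ ^ 4) + D₂ * ‖u x‖ ^ 2))) := by
  refine ⟨?_, exists_eLpNorm_le_integral_laplacian (.inr (by simp)) hp.le⟩
  obtain ⟨D₁, D₂, hD₁, hD₂, H⟩ :=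
    exists_eLpNorm_le_integral_laplacian (E := ℝ) (.inl (by simp)) hp.le
  have hline (u : ℝ → ℂ) (hu : IsTestFunctionOffZero u) :
      eLpNorm (fun x => ‖u x‖ ^ 2) p volume ≤ ENNReal.ofReal (∫ x : ℝ,
        (‖deriv (deriv u) x‖ ^ 2 - D₁ * (‖u x‖ ^ 2 / x ^ 4) + D₂ * ‖u x‖ ^ 2)) := by
    have h4 (x : ℝ) : |x| ^ 4 = x ^ 4 := by rw [(by decide : Even 4).pow_abs]
    simpa [iteratedDeriv_succ, h4] using H u hu
  refine ⟨D₁, D₂, hD₁, hD₂, fun u hu => ⟨?_, hline u hu⟩⟩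
  -- The half-line estimate is the whole-line one for the truncated function, with the same
  -- constants.
  have h := hline _ hu.indicator_Ioi
  rw [← eLpNorm_indicator_eq_eLpNorm_restrict measurableSet_Ioi, ← integral_indicator
    measurableSet_Ioi]
  convert h using 4 with x x
  · by_cases hx : x ∈ Ioi (0 : ℝ) <;> simp [hx]
  · rw [deriv_deriv_indicator_Ioi hu]
    by_cases hx : x ∈ Ioi (0 : ℝ) <;> simp [hx]
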